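/- Let $f$ be a meromorphic function on $\mathbb{C}$ of order greater than $2$, where the order of $f$ is $$\rho(f)=\limsup_{r\to\infty}\frac{\log^+T(r,f)}{\log r}\in[0,\infty]$$ and $T(r,f)$ denotes the Nevanlinna characteristic of $f$. Then the family of translates $$\mathcal{F}=\{f(z+\omega):\omega\in\mathbb{C}\}$$ is not normal at any point $z_0\in\mathbb{C}$; that is, there is no open neighbourhood $D$ of $z_0$ such that every sequence in $\mathcal{F}$ has a subsequence converging spherically uniformly on compact subsets of $D$. (Here spherically uniform convergence means uniform convergence with respect to the chordal metric on $\mathbb{C}\cup\{\infty\}$, and the limit function may be identically $\infty$.) -/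

import Mathlib

open Filter Topology

noncomputable section

/-- The chordal metric on the Riemann sphere `ℂ ∪ {∞}`. -/
def chordalDist : OnePoint ℂ → OnePoint ℂ → ℝ
  | OnePoint.some z, OnePoint.some w =>
      ‖z - w‖ / (Real.sqrt (1 + ‖z‖ ^ 2) * Real.sqrt (1 + ‖w‖ ^ 2))
  | OnePoint.some z, OnePoint.infty => 1 / Real.sqrt (1 + ‖z‖ ^ 2)
  | OnePoint.infty, OnePoint.some w => 1 / Real.sqrt (1 + ‖w‖ ^ 2)
  | OnePoint.infty, OnePoint.infty => 0

open Classical in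
/-- The value in `ℂ ∪ {∞}` at `z` of a function meromorphic at `z`: it is `∞` if `z` is a pole and
the limit of `f` at `z` otherwise. In Mathlib a meromorphic function `ℂ → ℂ` carries arbitrary
complex values at its poles and at removable singularities; this undoes that convention. -/
def sphereValue (f : ℂ → ℂ) (z : ℂ) : OnePoint ℂ :=
  if meromorphicOrderAt f z < 0 then OnePoint.infty
  else OnePoint.some (limUnder (𝓝[≠] z) f)

/-- The sequence `u` of meromorphic functions converges to `g` spherically uniformly on compact
subsets of `D`. -/
def TendstoSphericallyUniformlyOnCompacts
    (u : ℕ → ℂ → ℂ) (g : ℂ → OnePoint ℂ) (D : Set ℂ) : Prop :=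
  ∀ K : Set ℂ, IsCompact K → K ⊆ D → ∀ ε : ℝ, 0 < ε →
    ∃ N : ℕ, ∀ n : ℕ, N ≤ n → ∀ z ∈ K, chordalDist (sphereValue (u n) z) (g z) < ε

/-- A family `𝓕` of meromorphic functions is normal in `D` if every sequence in `𝓕` has a
subsequence that converges spherically uniformly on compact subsets of `D`
(the limit function may take the value `∞`, and may be identically `∞`). -/
def IsNormalFamilyOn (𝓕 : Set (ℂ → ℂ)) (D : Set ℂ) : Prop :=
  ∀ u : ℕ → ℂ → ℂ, (∀ n, u n ∈ 𝓕) →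
    ∃ φ : ℕ → ℕ, StrictMono φ ∧ ∃ g : ℂ → OnePoint ℂ,
      TendstoSphericallyUniformlyOnCompacts (fun n => u (φ n)) g D

/-- A family is normal at `z₀` if it is normal in some open neighbourhood of `z₀`. -/
def IsNormalFamilyAt (𝓕 : Set (ℂ → ℂ)) (z₀ : ℂ) : Prop :=
  ∃ D : Set ℂ, IsOpen D ∧ z₀ ∈ D ∧ IsNormalFamilyOn 𝓕 D

/-- The order `limsup_{r → ∞} log⁺ T(r, f) / log r ∈ [0, ∞]` of a meromorphic function on `ℂ`,
where `T(r, f)` is the Nevanlinna characteristic. -/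
def nevanlinnaOrder (f : ℂ → ℂ) : EReal :=
  limsup (fun r : ℝ =>
    ((Real.posLog (ValueDistribution.characteristic f ⊤ r) / Real.log r : ℝ) : EReal)) atTop

/-- The family `{f(z + ω) : ω ∈ ℂ}` of all translates of `f`. -/
def translates (f : ℂ → ℂ) : Set (ℂ → ℂ) :=
  Set.range fun ω : ℂ => fun z : ℂ => f (z + ω)

end

/-! Normality of the translates at one point makes $f$ equicontinuous, in the chordal metric,
uniformly over the whole plane. So there is a fixed $d>0$ such that on every disc of radius $2d$
either $|f|\le 2$ or $|1/f|\le 2$ (`exists_radius_of_isNormalFamilyAt`). For the translate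
$f_w(z)=f(z+w)$ this gives $T(2d,f_w)-T(d,f_w)\le\log 2$.

To pass from local to global, Cartan's identity writes increments of $T$ as averages over $|a|=1$ of
increments of the counting functions of $a$-points, which are sums over points. Covering $|z|\le r$
by $O(r^2)$ discs of radius $d$ then bounds $T(r,f)-T(1,f)$ by $\log r/\log 2$ times the sum of the
local increments (`characteristic_sub_le_sum_translates`). Hence $T(r,f)=O(r^2\log r)$, and the
order is at most 2. -/

open Function Real

/-! ### Counting functions as weighted sums over points -/

/-- The contribution of a point `z` to the increment from `s` to `r` of a logarithmic counting
function. -/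
noncomputable def logWeight (s r : ℝ) (z : ℂ) : ℝ :=
  if ‖z‖ ≤ s then log (r / s) else if ‖z‖ ≤ r then log (r / ‖z‖) else 0

lemma logCounting_eq_sum (D : locallyFinsupp ℂ ℤ) {r : ℝ} (hr : 0 < r) (S : Finset ℂ)
    (hS : ∀ z, D z ≠ 0 → ‖z‖ ≤ r → z ∈ S) :
    locallyFinsuppWithin.logCounting D r =
      ∑ z ∈ S, (D z : ℝ) * (if z = 0 then log r else if ‖z‖ ≤ r then log (r / ‖z‖) else 0) := by
  have hmem : ∀ z : ℂ, z ∈ Metric.closedBall (0 : ℂ) |r| ↔ ‖z‖ ≤ r := by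
    intro z; simp [abs_of_pos hr]
  -- The origin drops out of this sum since `log (r * 0⁻¹) = 0`; its share is the separate term `D 0
  -- * log r`.
  have h1 : ∀ z : ℂ, ((locallyFinsuppWithin.toClosedBall r D z : ℤ) : ℝ) * log (r * ‖z‖⁻¹) =
      (D z : ℝ) * (if z = 0 then 0 else if ‖z‖ ≤ r then log (r / ‖z‖) else 0) := by
    intro z
    by_cases hz : ‖z‖ ≤ r
    · rw [locallyFinsuppWithin.toClosedBall_eval_within D ((hmem z).2 hz)]
      by_cases h0 : z = 0
      · simp [h0]
      · simp [h0, hz, div_eq_mul_inv]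
    · rw [locallyFinsuppWithin.apply_eq_zero_of_notMem _ (fun h => hz ((hmem z).1 h))]
      have h0 : z ≠ 0 := by rintro rfl; simp [hr.le] at hz
      simp [h0, hz]
  have h2 : (D 0 : ℝ) * log r = ∑ z ∈ S, (D z : ℝ) * (if z = 0 then log r else 0) := by
    by_cases h : (0 : ℂ) ∈ S
    · simp [h]
    · have : D 0 = 0 := by
        by_contra hD
        exact h (hS 0 hD (by simpa using hr.le))
      simp [this, h]
  change ∑ᶠ z, ((locallyFinsuppWithin.toClosedBall r D z : ℤ) : ℝ) * log (r * ‖z‖⁻¹)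
    + (D 0 : ℝ) * log r = _
  rw [finsum_congr h1, h2, finsum_eq_sum_of_support_subset (s := S), ← Finset.sum_add_distrib]
  · refine Finset.sum_congr rfl fun z _ => ?_
    split_ifs <;> ring
  · intro z hz
    rw [Function.mem_support] at hz
    have hD : D z ≠ 0 := by rintro h; simp [h] at hz
    refine hS z hD ?_
    by_contra h
    simp [h] at hz

lemma logCounting_sub_logCounting_eq_sum (D : locallyFinsupp ℂ ℤ) {s r : ℝ} (hs : 0 < s)
    (hsr : s ≤ r) (S : Finset ℂ) (hS : ∀ z, D z ≠ 0 → ‖z‖ ≤ r → z ∈ S) :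
    locallyFinsuppWithin.logCounting D r - locallyFinsuppWithin.logCounting D s =
      ∑ z ∈ S, (D z : ℝ) * logWeight s r z := by
  have hr : 0 < r := hs.trans_le hsr
  rw [logCounting_eq_sum D hr S hS,
    logCounting_eq_sum D hs S (fun z h h' => hS z h (h'.trans hsr)), ← Finset.sum_sub_distrib]
  refine Finset.sum_congr rfl fun z _ => ?_
  rw [← mul_sub]
  congr 1
  unfold logWeight
  by_cases h0 : z = 0
  · simp [h0, hs.le, log_div hr.ne' hs.ne']
  have hz : ‖z‖ ≠ 0 := by simpa using h0
  by_cases h1 : ‖z‖ ≤ s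
  · simp only [h0, if_false, h1, if_true, h1.trans hsr]
    rw [log_div hr.ne' hz, log_div hs.ne' hz, log_div hr.ne' hs.ne']
    ring
  · simp [h0, h1]

lemma logWeight_nonneg {s r : ℝ} (hs : 0 < s) (hsr : s ≤ r) (z : ℂ) : 0 ≤ logWeight s r z := by
  unfold logWeight
  split_ifs with h1 h2
  · exact log_nonneg ((one_le_div hs).2 hsr)
  · have : 0 < ‖z‖ := hs.trans (not_le.1 h1)
    exact log_nonneg ((one_le_div this).2 h2)
  · exact le_rfl

lemma logWeight_one_le_log {r : ℝ} (z : ℂ) (hz : ‖z‖ ≤ r) (hr : 1 ≤ r) :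
    logWeight 1 r z ≤ log r := by
  unfold logWeight
  split_ifs with h1
  · simp
  · have : 1 < ‖z‖ := not_le.1 h1
    exact log_le_log (by positivity) (div_le_self (by positivity) this.le)

/-- A centre within `d` of `z` already contributes the full `log 2`, against at most `log r` on the
left; the other terms are nonnegative. -/
lemma logWeight_one_le_sum (W : Finset ℂ) {d r : ℝ} (hd : 0 < d) (hr : 1 ≤ r)
    (hW : ∀ z : ℂ, ‖z‖ ≤ r → ∃ w ∈ W, ‖z - w‖ ≤ d) (z : ℂ) :
    logWeight 1 r z ≤ log r / log 2 * ∑ w ∈ W, logWeight d (2 * d) (z - w) := by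
  have hl : 0 < log 2 := log_pos one_lt_two
  have hlr : 0 ≤ log r := log_nonneg hr
  have hnn : ∀ w ∈ W, 0 ≤ logWeight d (2 * d) (z - w) :=
    fun w _ => logWeight_nonneg hd (by linarith) _
  by_cases hz : ‖z‖ ≤ r
  · obtain ⟨w, hw, hzw⟩ := hW z hz
    have h1 : logWeight d (2 * d) (z - w) = log 2 := by
      unfold logWeight
      rw [if_pos hzw, mul_div_assoc, div_self hd.ne', mul_one]
    have h2 := Finset.single_le_sum hnn hw
    rw [h1] at h2
    calc logWeight 1 r z ≤ log r := logWeight_one_le_log z hz hr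
      _ = log r / log 2 * log 2 := by field_simp
      _ ≤ _ := by gcongr
  · have h1 : ¬ ‖z‖ ≤ 1 := fun h => hz (h.trans hr)
    have : logWeight 1 r z = 0 := by simp [logWeight, h1, hz]
    rw [this]
    exact mul_nonneg (by positivity) (Finset.sum_nonneg hnn)

/-- If the discs of radius `d` about the points of `W` cover the disc of radius `r` about `0`, the
growth of a counting function is controlled by that of its translates. -/
lemma logCounting_sub_le_sum_translates (D : locallyFinsupp ℂ ℤ) (hD : ∀ z, 0 ≤ D z)
    (E : ℂ → locallyFinsupp ℂ ℤ) (hE : ∀ w z, E w z = D (z + w))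
    (W : Finset ℂ) {d r : ℝ} (hd : 0 < d) (hr : 1 ≤ r)
    (hW : ∀ z : ℂ, ‖z‖ ≤ r → ∃ w ∈ W, ‖z - w‖ ≤ d) :
    locallyFinsuppWithin.logCounting D r - locallyFinsuppWithin.logCounting D 1 ≤
      log r / log 2 * ∑ w ∈ W, (locallyFinsuppWithin.logCounting (E w) (2 * d) -
        locallyFinsuppWithin.logCounting (E w) d) := by
  -- Large enough that one finite set `S` serves every counting function involved, so the two sums
  -- can be exchanged.
  set B : ℝ := r + 2 * d + ∑ w ∈ W, ‖w‖ with hB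
  have hsum : 0 ≤ ∑ w ∈ W, ‖w‖ := Finset.sum_nonneg fun _ _ => norm_nonneg _
  have hB0 : 0 ≤ B := by positivity
  obtain ⟨S, hS⟩ : ∃ S : Finset ℂ, ∀ z, D z ≠ 0 → ‖z‖ ≤ B → z ∈ S := by
    have hfin := (locallyFinsuppWithin.toClosedBall B D).finiteSupport (isCompact_closedBall 0 |B|)
    refine ⟨hfin.toFinset, fun z hz hzB => ?_⟩
    rw [Set.Finite.mem_toFinset, Function.mem_support,
      locallyFinsuppWithin.toClosedBall_eval_within D (by simpa [abs_of_nonneg hB0] using hzB)]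
    exact hz
  have hE' : ∀ w ∈ W, locallyFinsuppWithin.logCounting (E w) (2 * d) -
      locallyFinsuppWithin.logCounting (E w) d =
      ∑ z ∈ S, (D z : ℝ) * logWeight d (2 * d) (z - w) := by
    intro w hw
    have hinj : Set.InjOn (fun z : ℂ => z - w) S := fun a _ b _ h => sub_left_injective h
    rw [logCounting_sub_logCounting_eq_sum (E w) hd (by linarith) (S.image fun z => z - w),
      Finset.sum_image hinj]
    · refine Finset.sum_congr rfl fun z _ => ?_
      rw [hE, sub_add_cancel]
    · intro z hz hzd
      rw [hE] at hz
      refine Finset.mem_image.2 ⟨z + w, hS _ hz ?_, by simp⟩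
      have h1 := Finset.single_le_sum (f := fun w : ℂ => ‖w‖) (fun _ _ => norm_nonneg _) hw
      have h2 := norm_add_le z w
      linarith
  rw [logCounting_sub_logCounting_eq_sum D one_pos hr S
    (fun z h h' => hS z h (by linarith)), Finset.sum_congr rfl hE', Finset.sum_comm,
    Finset.mul_sum]
  refine Finset.sum_le_sum fun z _ => ?_
  rw [← Finset.mul_sum, mul_left_comm]
  exact mul_le_mul_of_nonneg_left (logWeight_one_le_sum W hd hr hW z) (by exact_mod_cast hD z)

/-! ### Cartan's identity and translates -/

lemma Meromorphic.comp_add_const {f : ℂ → ℂ} (hf : Meromorphic f) (w : ℂ) :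
    Meromorphic fun z => f (z + w) := by
  intro z
  exact MeromorphicAt.comp_analyticAt (f := f) (g := fun z => z + w) (hf (z + w)) (by fun_prop)

lemma divisor_translate_apply {f : ℂ → ℂ} (hf : Meromorphic f) (w z : ℂ) :
    MeromorphicOn.divisor (fun z => f (z + w)) Set.univ z =
      MeromorphicOn.divisor f Set.univ (z + w) := by
  rw [MeromorphicOn.divisor_apply (hf.comp_add_const w).meromorphicOn (Set.mem_univ _),
    MeromorphicOn.divisor_apply hf.meromorphicOn (Set.mem_univ _)]
  congr 1
  exact meromorphicOrderAt_comp_add_const_eq_meromorphicOrderAt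

open ValueDistribution in
lemma characteristic_sub_le_sum_translates {f : ℂ → ℂ} (hf : Meromorphic f)
    (W : Finset ℂ) {d r : ℝ} (hd : 0 < d) (hr : 1 ≤ r)
    (hW : ∀ z : ℂ, ‖z‖ ≤ r → ∃ w ∈ W, ‖z - w‖ ≤ d) :
    characteristic f ⊤ r - characteristic f ⊤ 1 ≤ log r / log 2 *
      ∑ w ∈ W, (characteristic (fun z => f (z + w)) ⊤ (2 * d) -
        characteristic (fun z => f (z + w)) ⊤ d) := by
  -- The additive constant in Cartan's identity does not depend on the radius, so it cancels in
  -- increments.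
  have key : ∀ g : ℂ → ℂ, Meromorphic g → ∀ a ≠ 0, ∀ b ≠ 0,
      characteristic g ⊤ a - characteristic g ⊤ b =
        circleAverage (fun x => logCounting g x a - logCounting g x b) 0 1 := by
    intro g hg a ha b hb
    obtain ⟨c, hc⟩ := characteristic_top_eq_circleAverage_add_const hg
    have := circleAverage_sub (circleIntegrable_logCounting (R := a) hg)
      (circleIntegrable_logCounting (R := b) hg)
    change circleAverage (fun x => logCounting g x a - logCounting g x b) 0 1 = _ at this
    rw [hc a ha, hc b hb, this]
    ring
  have hint : ∀ w ∈ W, CircleIntegrable (fun x : ℂ =>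
      logCounting (fun z => f (z + w)) x (2 * d) - logCounting (fun z => f (z + w)) x d) 0 1 :=
    fun w _ => (circleIntegrable_logCounting (hf.comp_add_const w)).sub
      (circleIntegrable_logCounting (hf.comp_add_const w))
  rw [key f hf r (by positivity) 1 one_ne_zero,
    Finset.sum_congr rfl fun w _ => key _ (hf.comp_add_const w) (2 * d) (by positivity) d hd.ne',
    ← circleAverage_fun_sum hint, ← smul_eq_mul, ← circleAverage_fun_smul]
  refine circleAverage_mono ((circleIntegrable_logCounting hf).sub
    (circleIntegrable_logCounting hf)) ?_ fun x _ => ?_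
  · have := (CircleIntegrable.sum W hint).const_fun_smul (a := log r / log 2)
    simpa [Finset.sum_apply] using this
  · simp only [logCounting_coe, smul_eq_mul]
    have hfx : Meromorphic fun z => f z - x := hf.sub (Meromorphic.const x)
    refine logCounting_sub_le_sum_translates _ (fun z => ?_) _ (fun w z => ?_) W hd hr hW
    · rw [locallyFinsuppWithin.posPart_apply]
      exact posPart_nonneg _
    · rw [locallyFinsuppWithin.posPart_apply, locallyFinsuppWithin.posPart_apply,
        divisor_translate_apply hfx w z]

/-! ### Increments of the characteristic where $g$ or $1/g$ is bounded -/

open ValueDistribution in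
lemma characteristic_top_eq_proximity_of_no_poles {g : ℂ → ℂ} (hg : Meromorphic g) {R : ℝ}
    (hR : 0 < R) (ho : ∀ z, ‖z‖ ≤ R → 0 ≤ meromorphicOrderAt g z) :
    characteristic g ⊤ R = proximity g ⊤ R := by
  have h1 : logCounting g ⊤ R = 0 := by
    rw [logCounting_top, logCounting_eq_sum _ hR ∅]
    · simp
    · intro z hz hzR
      refine absurd ?_ hz
      rw [locallyFinsuppWithin.negPart_apply,
        MeromorphicOn.divisor_apply hg.meromorphicOn (Set.mem_univ _), negPart_eq_zero]
      exact WithTop.untop₀_nonneg.2 (ho z hzR)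
  change proximity g ⊤ R + logCounting g ⊤ R = _
  rw [h1, add_zero]

open ValueDistribution in
lemma characteristic_top_sub_le_log_two {g : ℂ → ℂ} (hg : Meromorphic g) {s R : ℝ} (hs : 0 < s)
    (hsR : s ≤ R) (ho : ∀ z, ‖z‖ ≤ R → 0 ≤ meromorphicOrderAt g z)
    (hb : ∀ z, ‖z‖ ≤ R → ‖g z‖ ≤ 2) :
    characteristic g ⊤ R - characteristic g ⊤ s ≤ log 2 := by
  have hR : 0 < R := hs.trans_le hsR
  have h2 : proximity g ⊤ R ≤ log 2 := by
    rw [proximity_top]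
    refine circleAverage_mono_on_of_le_circle hg.meromorphicOn.circleIntegrable_posLog_norm ?_
    intro z hz
    have : ‖z‖ = R := by simpa [abs_of_pos hR] using hz
    calc posLog ‖g z‖ ≤ posLog 2 := posLog_le_posLog (norm_nonneg _) (hb z this.le)
      _ = log 2 := posLog_eq_log (by norm_num)
  have h3 : 0 ≤ proximity g ⊤ s := proximity_nonneg s
  rw [characteristic_top_eq_proximity_of_no_poles hg hR ho,
    characteristic_top_eq_proximity_of_no_poles hg hs fun z hz => ho z (hz.trans hsR)]
  linarith

open ValueDistribution in
-- By Jensen's formula $T(R,g)-T(R,1/g)$ is independent of $R\ne 0$, so $g$ and $1/g$ have equal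
-- increments.
lemma characteristic_top_sub_le_log_two_of_inv {g : ℂ → ℂ} (hg : Meromorphic g) {s R : ℝ}
    (hs : 0 < s) (hsR : s ≤ R) (ho : ∀ z, ‖z‖ ≤ R → 0 ≤ meromorphicOrderAt g⁻¹ z)
    (hb : ∀ z, ‖z‖ ≤ R → ‖g⁻¹ z‖ ≤ 2) :
    characteristic g ⊤ R - characteristic g ⊤ s ≤ log 2 := by
  have h1 := characteristic_top_sub_le_log_two hg.inv hs hsR ho hb
  have h2 := characteristic_sub_characteristic_inv_of_ne_zero hg (hs.trans_le hsR).ne'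
  have h3 := characteristic_sub_characteristic_inv_of_ne_zero hg hs.ne'
  linarith

/-! ### Chordal distance to infinity and equicontinuity -/

lemma abs_sqrt_one_add_sq_sub_le (x y : ℝ) :
    |√(1 + x ^ 2) - √(1 + y ^ 2)| ≤ |x - y| := by
  have hx := Real.sq_sqrt (show 0 ≤ 1 + x ^ 2 by positivity)
  have hy := Real.sq_sqrt (show 0 ≤ 1 + y ^ 2 by positivity)
  have h0x := Real.sqrt_nonneg (1 + x ^ 2)
  have h0y := Real.sqrt_nonneg (1 + y ^ 2)
  rw [← sq_le_sq]
  have : 1 + x * y ≤ √(1 + x ^ 2) * √(1 + y ^ 2) := by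
    refine le_of_abs_le (abs_le_of_sq_le_sq ?_ (by positivity))
    rw [mul_pow, hx, hy]
    nlinarith [sq_nonneg (x - y)]
  nlinarith

/-- Transfers chordal convergence to the real function "distance to ∞", which is all the proof needs
of the spherical metric. -/
lemma abs_chordalDist_infty_sub_le (p q : OnePoint ℂ) :
    |chordalDist p OnePoint.infty - chordalDist q OnePoint.infty| ≤ chordalDist p q := by
  induction p using OnePoint.rec with
  | infty =>
    induction q using OnePoint.rec with
    | infty => simp [chordalDist]
    | coe w =>
      change |0 - 1 / √(1 + ‖w‖ ^ 2)| ≤ 1 / √(1 + ‖w‖ ^ 2)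
      rw [zero_sub, abs_neg, abs_of_nonneg (by positivity)]
  | coe z =>
    induction q using OnePoint.rec with
    | infty =>
      change |1 / √(1 + ‖z‖ ^ 2) - 0| ≤ 1 / √(1 + ‖z‖ ^ 2)
      rw [sub_zero, abs_of_nonneg (by positivity)]
    | coe w =>
      change |1 / √(1 + ‖z‖ ^ 2) - 1 / √(1 + ‖w‖ ^ 2)| ≤
        ‖z - w‖ / (√(1 + ‖z‖ ^ 2) * √(1 + ‖w‖ ^ 2))
      have hz : 0 < √(1 + ‖z‖ ^ 2) := Real.sqrt_pos.2 (by positivity)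
      have hw : 0 < √(1 + ‖w‖ ^ 2) := Real.sqrt_pos.2 (by positivity)
      rw [div_sub_div _ _ hz.ne' hw.ne', abs_div, abs_of_pos (mul_pos hz hw), one_mul, mul_one]
      gcongr
      calc |√(1 + ‖w‖ ^ 2) - √(1 + ‖z‖ ^ 2)| ≤ |‖w‖ - ‖z‖| := abs_sqrt_one_add_sq_sub_le _ _
        _ = |‖z‖ - ‖w‖| := abs_sub_comm _ _
        _ ≤ ‖z - w‖ := abs_norm_sub_norm_le _ _

lemma sphereValue_translate (f : ℂ → ℂ) (w z : ℂ) :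
    sphereValue (fun z => f (z + w)) z = sphereValue f (z + w) := by
  have h1 : meromorphicOrderAt (fun z => f (z + w)) z = meromorphicOrderAt f (z + w) :=
    meromorphicOrderAt_comp_add_const_eq_meromorphicOrderAt
  have h2 : map (fun z => z + w) (𝓝[≠] z) = 𝓝[≠] (z + w) := by
    simp
  have h3 : limUnder (𝓝[≠] z) (fun z => f (z + w)) = limUnder (𝓝[≠] (z + w)) f := by
    unfold limUnder
    rw [← h2, Filter.map_map]
    rfl
  unfold sphereValue
  rw [h1, h3]

lemma sphereValue_congr {f g : ℂ → ℂ} {z : ℂ} (h : f =ᶠ[𝓝[≠] z] g) :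
    sphereValue f z = sphereValue g z := by
  unfold sphereValue limUnder
  rw [meromorphicOrderAt_congr h, Filter.map_congr h]

lemma sphereValue_of_analyticAt {f : ℂ → ℂ} {z : ℂ} (h : AnalyticAt ℂ f z) :
    sphereValue f z = OnePoint.some (f z) := by
  have h1 : ¬ meromorphicOrderAt f z < 0 := not_lt.2 h.meromorphicOrderAt_nonneg
  unfold sphereValue
  rw [if_neg h1, (h.continuousAt.tendsto.mono_left nhdsWithin_le_nhds).limUnder_eq]

lemma continuousAt_chordalDist_sphereValue_infty {f : ℂ → ℂ} (hf : Meromorphic f) (z₀ : ℂ) :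
    ContinuousAt (fun z => chordalDist (sphereValue f z) OnePoint.infty) z₀ := by
  rw [continuousAt_iff_punctured_nhds]
  have h1 : (fun z => 1 / √(1 + ‖f z‖ ^ 2)) =ᶠ[𝓝[≠] z₀]
      fun z => chordalDist (sphereValue f z) OnePoint.infty := by
    filter_upwards [(hf z₀).eventually_analyticAt] with z hz
    rw [sphereValue_of_analyticAt hz]
    rfl
  refine Tendsto.congr' h1 ?_
  by_cases ho : meromorphicOrderAt f z₀ < 0
  · have h2 : sphereValue f z₀ = OnePoint.infty := if_pos ho
    rw [h2]
    change Tendsto _ _ (𝓝 0)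
    have h3 := tendsto_norm_cobounded_atTop.comp (tendsto_cobounded_of_meromorphicOrderAt_neg ho)
    have h4 : Tendsto (fun z => 1 + ‖f z‖ ^ 2) (𝓝[≠] z₀) atTop :=
      tendsto_atTop_add_const_left _ _ ((tendsto_pow_atTop two_ne_zero).comp h3)
    simp only [one_div]
    exact tendsto_inv_atTop_zero.comp (Real.tendsto_sqrt_atTop.comp h4)
  · obtain ⟨c, hc⟩ := tendsto_nhds_of_meromorphicOrderAt_nonneg (hf z₀) (not_lt.1 ho)
    have h2 : sphereValue f z₀ = OnePoint.some c := by
      unfold sphereValue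
      rw [if_neg ho, hc.limUnder_eq]
    rw [h2]
    change Tendsto _ _ (𝓝 (1 / √(1 + ‖c‖ ^ 2)))
    have hne : √(1 + ‖c‖ ^ 2) ≠ 0 := (Real.sqrt_pos.2 (by positivity)).ne'
    exact tendsto_const_nhds.div (tendsto_const_nhds.add (hc.norm.pow 2)).sqrt hne

/-- If the translates of `f` form a normal family at some point, then on all discs of a fixed small
radius `f` either stays away from `∞` or stays away from `0`. -/
lemma exists_radius_of_isNormalFamilyAt {f : ℂ → ℂ} (hf : Meromorphic f) {z₀ : ℂ}
    (h : IsNormalFamilyAt (translates f) z₀) :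
    ∃ d : ℝ, 0 < d ∧ ∀ w : ℂ,
      (∀ z, ‖z - w‖ ≤ d → 46 / 100 ≤ chordalDist (sphereValue f z) OnePoint.infty) ∨
      (∀ z, ‖z - w‖ ≤ d → chordalDist (sphereValue f z) OnePoint.infty ≤ 88 / 100) := by
  set H : ℂ → ℝ := fun z => chordalDist (sphereValue f z) OnePoint.infty with hH
  obtain ⟨D, hDo, hzD, hD⟩ := h
  obtain ⟨ρ, hρ, hρD⟩ := Metric.nhds_basis_closedBall.mem_iff.1 (hDo.mem_nhds hzD)
  by_contra hcon
  push Not at hcon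
  choose w hw1 hw2 using fun n : ℕ => hcon (1 / ((n : ℝ) + 1)) (by positivity)
  -- These translates carry `z₀` to the bad centres `w n`.
  obtain ⟨φ, hφ, g, hg⟩ := hD (fun n z => f (z + (w n - z₀))) fun n => ⟨w n - z₀, rfl⟩
  obtain ⟨N, hN⟩ := hg _ (isCompact_closedBall z₀ ρ) hρD (4 / 100) (by norm_num)
  have hN' : ∀ n, N ≤ n → ∀ z, ‖z - z₀‖ ≤ ρ →
      |H (z + (w (φ n) - z₀)) - chordalDist (g z) OnePoint.infty| < 4 / 100 := by
    intro n hn z hz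
    have h1 := hN n hn z (by simpa [dist_eq_norm] using hz)
    rw [sphereValue_translate] at h1
    exact (abs_chordalDist_infty_sub_le _ _).trans_lt h1
  -- Continuity of the single translate of index `N` replaces continuity of the limit `g`.
  have hcont : ContinuousAt (fun z => H (z + (w (φ N) - z₀))) z₀ := by
    have : ContinuousAt H (z₀ + (w (φ N) - z₀)) := continuousAt_chordalDist_sphereValue_infty hf _
    exact ContinuousAt.comp (f := fun z => z + (w (φ N) - z₀)) this (by fun_prop)
  obtain ⟨η, hη, hη'⟩ := Metric.continuousAt_iff.1 hcont (4 / 100) (by norm_num)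
  -- Five comparisons of size 4/100: translate `n` to `g` to translate `N` at `y`, across to `z₀`,
  -- and back through `g`. Two such oscillations total 40/100, less than the gap 88/100 − 46/100.
  have hosc : ∀ n, N ≤ n → ∀ z, ‖z - w (φ n)‖ < η → ‖z - w (φ n)‖ ≤ ρ →
      |H z - H (w (φ n))| < 20 / 100 := by
    intro n hn z hz1 hz2
    set y := z - w (φ n) + z₀ with hy
    have hy0 : y - z₀ = z - w (φ n) := by rw [hy]; ring
    have e1 := hN' n hn y (by rw [hy0]; exact hz2)
    have e2 := hN' n hn z₀ (by simpa using hρ.le)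
    have e3 := hN' N le_rfl y (by rw [hy0]; exact hz2)
    have e4 := hN' N le_rfl z₀ (by simpa using hρ.le)
    have e5 := hη' (x := y) (by rw [dist_eq_norm, hy0]; exact hz1)
    rw [Real.dist_eq] at e5
    have hy1 : y + (w (φ n) - z₀) = z := by rw [hy]; ring
    have hy2 : z₀ + (w (φ n) - z₀) = w (φ n) := by ring
    rw [hy1] at e1
    rw [hy2] at e2
    rw [abs_lt] at e1 e2 e3 e4 e5 ⊢
    constructor <;> linarith [e1.1, e1.2, e2.1, e2.2, e3.1, e3.2, e4.1, e4.2, e5.1, e5.2]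
  obtain ⟨M, hM⟩ := exists_nat_one_div_lt (lt_min hη hρ)
  set n := max N M with hn
  have hsmall : 1 / ((φ n : ℝ) + 1) < min η ρ := by
    refine lt_of_le_of_lt ?_ hM
    have : (M : ℝ) ≤ φ n := by exact_mod_cast (le_max_right N M).trans (hφ.id_le n)
    gcongr
  obtain ⟨z1, hz1, hz1'⟩ := hw1 (φ n)
  obtain ⟨z2, hz2, hz2'⟩ := hw2 (φ n)
  have o1 := abs_lt.1 (hosc n (le_max_left _ _) z1 (hz1.trans_lt (hsmall.trans_le (min_le_left _ _)))
    (hz1.trans (hsmall.le.trans (min_le_right _ _))))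
  have o2 := abs_lt.1 (hosc n (le_max_left _ _) z2 (hz2.trans_lt (hsmall.trans_le (min_le_left _ _)))
    (hz2.trans (hsmall.le.trans (min_le_right _ _))))
  change H z1 < _ at hz1'
  change _ < H z2 at hz2'
  linarith [o1.1, o1.2, o2.1, o2.2]

/-! ### From chordal bounds to bounds on $f$ and $1/f$ -/

lemma norm_le_two_of_chordalDist_infty_ge {w : ℂ}
    (h : 46 / 100 ≤ chordalDist (OnePoint.some w) OnePoint.infty) : ‖w‖ ≤ 2 := by
  -- Modulus 2 has chordal distance $1/\sqrt5<0.46$ to ∞; modulus 1/2 has $2/\sqrt5>0.88$.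
  change 46 / 100 ≤ 1 / √(1 + ‖w‖ ^ 2) at h
  have hs : 0 < √(1 + ‖w‖ ^ 2) := Real.sqrt_pos.2 (by positivity)
  have hsq := Real.sq_sqrt (show 0 ≤ 1 + ‖w‖ ^ 2 by positivity)
  rw [le_div_iff₀ hs] at h
  by_contra hc
  nlinarith [norm_nonneg w]

lemma one_half_le_norm_of_chordalDist_infty_le {w : ℂ}
    (h : chordalDist (OnePoint.some w) OnePoint.infty ≤ 88 / 100) : 1 / 2 ≤ ‖w‖ := by
  change 1 / √(1 + ‖w‖ ^ 2) ≤ 88 / 100 at h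
  have hs : 0 < √(1 + ‖w‖ ^ 2) := Real.sqrt_pos.2 (by positivity)
  have hsq := Real.sq_sqrt (show 0 ≤ 1 + ‖w‖ ^ 2 by positivity)
  rw [div_le_iff₀ hs] at h
  by_contra hc
  nlinarith [norm_nonneg w]

lemma MeromorphicNFAt.nonneg_order_and_norm_le {f : ℂ → ℂ} {z : ℂ} (hf : MeromorphicNFAt f z)
    (h : 46 / 100 ≤ chordalDist (sphereValue f z) OnePoint.infty) :
    0 ≤ meromorphicOrderAt f z ∧ ‖f z‖ ≤ 2 := by
  rcases meromorphicNFAt_iff_analyticAt_or.1 hf with ha | ⟨-, ho, -⟩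
  · rw [sphereValue_of_analyticAt ha] at h
    exact ⟨ha.meromorphicOrderAt_nonneg, norm_le_two_of_chordalDist_infty_ge h⟩
  · rw [show sphereValue f z = OnePoint.infty from if_pos ho] at h
    change (46 / 100 : ℝ) ≤ 0 at h
    norm_num at h

lemma MeromorphicNFAt.nonneg_order_inv_and_norm_inv_le {f : ℂ → ℂ} {z : ℂ}
    (hf : MeromorphicNFAt f z)
    (h : chordalDist (sphereValue f z) OnePoint.infty ≤ 88 / 100) :
    0 ≤ meromorphicOrderAt f⁻¹ z ∧ ‖f⁻¹ z‖ ≤ 2 := by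
  rcases meromorphicNFAt_iff_analyticAt_or.1 hf with ha | ⟨hm, ho, h0⟩
  · rw [sphereValue_of_analyticAt ha] at h
    have h1 := one_half_le_norm_of_chordalDist_infty_le h
    have hne : f z ≠ 0 := by
      rintro h0
      norm_num [h0] at h1
    refine ⟨(ha.inv hne).meromorphicOrderAt_nonneg, ?_⟩
    rw [Pi.inv_apply, norm_inv]
    exact inv_le_of_inv_le₀ (by norm_num) (by linarith)
  · refine ⟨(tendsto_nhds_iff_meromorphicOrderAt_nonneg hm.inv).1
      ⟨0, tendsto_inv₀_cobounded.comp (tendsto_cobounded_of_meromorphicOrderAt_neg ho)⟩, ?_⟩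
    -- A normal form takes the value 0 at a pole, and `0⁻¹ = 0`.
    simp [h0]

open ValueDistribution in
lemma characteristic_translate_sub_le_log_two {f : ℂ → ℂ} (hf : MeromorphicNFOn f Set.univ)
    {d : ℝ} (hd : 0 < d)
    (h : ∀ w : ℂ,
      (∀ z, ‖z - w‖ ≤ 2 * d → 46 / 100 ≤ chordalDist (sphereValue f z) OnePoint.infty) ∨
      (∀ z, ‖z - w‖ ≤ 2 * d → chordalDist (sphereValue f z) OnePoint.infty ≤ 88 / 100)) (w : ℂ) :
    characteristic (fun z => f (z + w)) ⊤ (2 * d) -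
      characteristic (fun z => f (z + w)) ⊤ d ≤ log 2 := by
  have hm : Meromorphic f := fun z => (hf (Set.mem_univ z)).meromorphicAt
  have hw : ∀ z : ℂ, ‖z‖ ≤ 2 * d → ‖z + w - w‖ ≤ 2 * d := fun z hz => by simpa using hz
  rcases h w with h1 | h1
  · refine characteristic_top_sub_le_log_two (hm.comp_add_const w) hd (by linarith)
      (fun z hz => ?_) (fun z hz => ?_)
    · have h2 : meromorphicOrderAt (fun z => f (z + w)) z = meromorphicOrderAt f (z + w) :=
        meromorphicOrderAt_comp_add_const_eq_meromorphicOrderAt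
      rw [h2]
      exact ((hf (Set.mem_univ _)).nonneg_order_and_norm_le (h1 _ (hw z hz))).1
    · exact ((hf (Set.mem_univ _)).nonneg_order_and_norm_le (h1 _ (hw z hz))).2
  · refine characteristic_top_sub_le_log_two_of_inv (hm.comp_add_const w) hd (by linarith)
      (fun z hz => ?_) (fun z hz => ?_)
    · have h2 : meromorphicOrderAt (fun z => f (z + w))⁻¹ z = meromorphicOrderAt f⁻¹ (z + w) :=
        meromorphicOrderAt_comp_add_const_eq_meromorphicOrderAt (f := f⁻¹)
      rw [h2]
      exact ((hf (Set.mem_univ _)).nonneg_order_inv_and_norm_inv_le (h1 _ (hw z hz))).1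
    · exact ((hf (Set.mem_univ _)).nonneg_order_inv_and_norm_inv_le (h1 _ (hw z hz))).2

/-! ### Covering by a lattice and the order bound -/

lemma exists_finset_cover_disc {d : ℝ} (hd : 0 < d) {r : ℝ} (hr : 1 ≤ r) :
    ∃ W : Finset ℂ, (∀ z : ℂ, ‖z‖ ≤ r → ∃ w ∈ W, ‖z - w‖ ≤ d) ∧
      (W.card : ℝ) ≤ (2 / d + 5) ^ 2 * r ^ 2 := by
  -- Centres lie on the lattice $d\mathbb{Z}^2$; rounding errs by at most $d/2$ per coordinate, and
  -- the extra 1 leaves room for rounding up.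
  set m : ℤ := ⌈r / d⌉ + 1 with hm
  set I : Finset ℤ := Finset.Icc (-m) m
  have hround : ∀ x : ℝ, |x| ≤ r → round (x / d) ∈ I ∧ |x - d * round (x / d)| ≤ d / 2 := by
    intro x hx
    have h1 := abs_sub_round (x / d)
    have h2 : |x / d| ≤ r / d := by
      rw [abs_div, abs_of_pos hd]
      gcongr
    have h3 := Int.le_ceil (r / d)
    rw [abs_le] at h1 h2
    refine ⟨Finset.mem_Icc.2 ⟨?_, ?_⟩, ?_⟩
    · have : (-m : ℝ) ≤ (round (x / d) : ℝ) := by rw [hm]; push_cast; linarith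
      exact_mod_cast this
    · have : (round (x / d) : ℝ) ≤ (m : ℝ) := by rw [hm]; push_cast; linarith
      exact_mod_cast this
    · have : x - d * round (x / d) = d * (x / d - round (x / d)) := by field_simp
      rw [this, abs_mul, abs_of_pos hd]
      nlinarith [abs_sub_round (x / d)]
  refine ⟨(I ×ˢ I).image fun p => ⟨d * (p.1 : ℝ), d * (p.2 : ℝ)⟩, fun z hz => ?_, ?_⟩
  · obtain ⟨h1, h1'⟩ := hround z.re ((Complex.abs_re_le_norm z).trans hz)
    obtain ⟨h2, h2'⟩ := hround z.im ((Complex.abs_im_le_norm z).trans hz)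
    refine ⟨_, Finset.mem_image.2 ⟨(_, _), Finset.mem_product.2 ⟨h1, h2⟩, rfl⟩, ?_⟩
    exact (Complex.norm_le_abs_re_add_abs_im _).trans ((add_le_add h1' h2').trans_eq (by ring))
  · have hm0 : 0 ≤ m := by have : 0 ≤ ⌈r / d⌉ := Int.ceil_nonneg (by positivity)
                           omega
    have hI : (I.card : ℝ) = 2 * m + 1 := by
      have : ((I.card : ℤ)) = 2 * m + 1 := by
        rw [Int.card_Icc, Int.toNat_of_nonneg (by omega)]
        ring
      exact_mod_cast this
    have hmr : (m : ℝ) ≤ r / d + 2 := by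
      rw [hm]
      push_cast
      linarith [Int.ceil_lt_add_one (r / d)]
    have hcard : (I.card : ℝ) ≤ (2 / d + 5) * r := by
      rw [hI]
      calc 2 * (m : ℝ) + 1 ≤ 2 * (r / d + 2) + 1 := by linarith
        _ = 2 / d * r + 5 := by ring
        _ ≤ (2 / d + 5) * r := by nlinarith
    calc (((I ×ˢ I).image _).card : ℝ) ≤ ((I ×ˢ I).card : ℝ) := by
          exact_mod_cast Finset.card_image_le
      _ = (I.card : ℝ) ^ 2 := by rw [Finset.card_product]; push_cast; ring
      _ ≤ ((2 / d + 5) * r) ^ 2 := by gcongr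
      _ = _ := by ring

open ValueDistribution in
lemma nevanlinnaOrder_le_two {f : ℂ → ℂ} {A C : ℝ}
    (h : ∀ r, 1 ≤ r → characteristic f ⊤ r ≤ A + C * (r ^ 2 * log r)) :
    nevanlinnaOrder f ≤ 2 := by
  refine EReal.le_of_forall_lt_iff_le.1 fun c hc => ?_
  have hc2 : 2 < c := EReal.coe_lt_coe_iff.1 hc
  have ho : (fun r : ℝ => A + C * (r ^ 2 * log r)) =o[atTop] fun r : ℝ => r ^ c := by
    refine Asymptotics.IsLittleO.add ?_ (Asymptotics.IsLittleO.const_mul_left ?_ C)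
    · exact Asymptotics.isLittleO_const_left.2
        (Or.inr (tendsto_norm_atTop_atTop.comp (tendsto_rpow_atTop (by linarith))))
    · have h1 := (Asymptotics.isBigO_refl (fun r : ℝ => r ^ 2) atTop).mul_isLittleO
        (isLittleO_log_rpow_atTop (sub_pos.2 hc2))
      refine h1.congr' EventuallyEq.rfl ?_
      filter_upwards [eventually_gt_atTop 0] with r hr
      rw [← Real.rpow_natCast, ← Real.rpow_add hr]
      norm_num
  refine limsup_le_of_le (by isBoundedDefault) ?_
  filter_upwards [ho.bound one_pos, eventually_gt_atTop 1] with r hr hr1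
  have hlog : 0 < log r := log_pos hr1
  have hrc : 1 ≤ r ^ c := Real.one_le_rpow hr1.le (by linarith)
  have h1 : characteristic f ⊤ r ≤ r ^ c := by
    rw [one_mul, Real.norm_of_nonneg (zero_le_one.trans hrc)] at hr
    exact (h r hr1.le).trans ((le_abs_self _).trans hr)
  have h2 : posLog (characteristic f ⊤ r) ≤ c * log r := by
    have h0 : 0 ≤ characteristic f ⊤ r := characteristic_nonneg hr1.le
    calc posLog (characteristic f ⊤ r) ≤ posLog (r ^ c) := posLog_le_posLog h0 h1
      _ = log (r ^ c) := posLog_eq_log (by rwa [abs_of_nonneg (zero_le_one.trans hrc)])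
      _ = c * log r := Real.log_rpow (by linarith) c
  exact_mod_cast (div_le_iff₀ hlog).2 h2


open ValueDistribution in
lemma nevanlinnaOrder_congr_codiscrete {f g : ℂ → ℂ} (h : f =ᶠ[codiscrete ℂ] g) :
    nevanlinnaOrder f = nevanlinnaOrder g := by
  refine limsup_congr ?_
  filter_upwards [eventually_ne_atTop 0] with r hr
  rw [characteristic_congr_codiscrete h hr]

open ValueDistribution in
/-- A meromorphic function whose translates form a normal family at some point has order at
most two. -/
theorem nevanlinnaOrder_le_two_of_isNormalFamilyAt {f : ℂ → ℂ} (hf : Meromorphic f) {z₀ : ℂ}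
    (h : IsNormalFamilyAt (translates f) z₀) : nevanlinnaOrder f ≤ 2 := by
  obtain ⟨e, he, hfe⟩ := exists_radius_of_isNormalFamilyAt hf h
  obtain ⟨d, rfl⟩ : ∃ d, e = 2 * d := ⟨e / 2, by ring⟩
  have hd : 0 < d := by linarith
  -- The bounds are needed at every point, but `f` may have arbitrary values on a discrete set;
  -- normalising changes neither sphere values nor order.
  set F := toMeromorphicNFOn f Set.univ with hF
  have hNF : MeromorphicNFOn F Set.univ := meromorphicNFOn_toMeromorphicNFOn f Set.univ
  have hFm : Meromorphic F := fun z => (hNF (Set.mem_univ z)).meromorphicAt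
  have hsv : ∀ z, sphereValue f z = sphereValue F z := fun z =>
    sphereValue_congr
      (MeromorphicOn.toMeromorphicNFOn_eq_self_on_nhdsNE hf.meromorphicOn (Set.mem_univ z)).symm
  simp only [hsv] at hfe
  rw [nevanlinnaOrder_congr_codiscrete (toMeromorphicNFOn_eqOn_codiscrete hf.meromorphicOn)]
  refine nevanlinnaOrder_le_two (A := characteristic F ⊤ 1) (C := (2 / d + 5) ^ 2) fun r hr => ?_
  obtain ⟨W, hW, hcard⟩ := exists_finset_cover_disc hd hr
  have hlog : 0 ≤ log r := log_nonneg hr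
  have hl2 : 0 < log 2 := log_pos one_lt_two
  have h1 := characteristic_sub_le_sum_translates hFm W hd hr hW
  have h2 : ∑ w ∈ W, (characteristic (fun z => F (z + w)) ⊤ (2 * d) -
      characteristic (fun z => F (z + w)) ⊤ d) ≤ W.card • log 2 :=
    Finset.sum_le_card_nsmul _ _ _ fun w _ => characteristic_translate_sub_le_log_two hNF hd hfe w
  rw [nsmul_eq_mul] at h2
  have h3 := calc
    characteristic F ⊤ r - characteristic F ⊤ 1 ≤ log r / log 2 * (W.card * log 2) :=
        h1.trans (by gcongr)
    _ = W.card * log r := by field_simp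
    _ ≤ (2 / d + 5) ^ 2 * r ^ 2 * log r := by gcongr
  linarith

theorem corollary2p2 (f : ℂ → ℂ) (hf : Meromorphic f) (hord : 2 < nevanlinnaOrder f) (z₀ : ℂ) :
    ¬ IsNormalFamilyAt (translates f) z₀ :=
  fun h => hord.not_ge (nevanlinnaOrder_le_two_of_isNormalFamilyAt hf h)
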